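/- A gyrogroup is a nonempty set $G$ with a binary operation $\oplus$ such that: (1) there is a unique element $1\in G$ with $1\oplus g=g=g\oplus 1$ for all $g\in G$; (2) each $g\in G$ has a unique inverse $\ominus g\in G$ with $\ominus g\oplus g=1=g\oplus(\ominus g)$; (3) for all $g,h\in G$ there is an automorphism $\operatorname{gyr}[g,h]$ of $(G,\oplus)$ with $g\oplus(h\oplus f)=(g\oplus h)\oplus\operatorname{gyr}[g,h](f)$ for all $f\in G$; (4) $\operatorname{gyr}[g,h]=\operatorname{gyr}[g\oplus h,h]$ for all $g,h\in G$. A subgyrogroup of $G$ is a nonempty subset closed under $\oplus$ and $\ominus$; the subgyrogroup generated by $S\subseteq G$ is the smallest subgyrogroup containing $S$. A strongly topologically orderable gyrogroup is a gyrogroup $G$ with a topology such that $\oplus\colon G\times G\to G$ and $\ominus\colon G\to G$ are continuous, the identity $1$ has a neighborhood base $\mathcal U$ with $\operatorname{gyr}[x,y](U)=U$ for all $x,y\in G$ and $U\in\mathcal U$, and the topology of $G$ is the order topology of some total order on $G$. **Theorem.** Let $G$ be a locally compact strongly topologically orderable gyrogroup. Then $G$ is metrizable, and $G$ has a suitable set: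 there is a subset $S\subseteq G$ that is discrete in its subspace topology, such that $S\cup\{1\}$ is closed in $G$ and the subgyrogroup generated by $S$ is dense in $G$. -/

import Mathlib

open Topology

/-- A gyrogroup. The operation `⊕` is written `*`, the inverse `⊖` is written `⁻¹` and the
identity element is `1`; `MulAut G` is the group of automorphisms of the magma `(G, ⊕)`.
The uniqueness of the identity, of the inverses and of the maps `gyr g h` follows from these
axioms, see `Gyrogroup.one_unique`, `Gyrogroup.inv_unique` and `Gyrogroup.gyr_unique`. -/
class Gyrogroup (G : Type*) extends Mul G, One G, Inv G where
  one_op : ∀ g : G, 1 * g = g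
  op_one : ∀ g : G, g * 1 = g
  inv_op : ∀ g : G, g⁻¹ * g = 1
  op_inv : ∀ g : G, g * g⁻¹ = 1
  /-- The gyroautomorphism `gyr[g, h]`. -/
  gyr : G → G → MulAut G
  /-- The left gyroassociative law. -/
  gyr_assoc : ∀ g h f : G, g * (h * f) = (g * h) * gyr g h f
  /-- The left loop property. -/
  gyr_loop : ∀ g h : G, gyr g h = gyr (g * h) h

namespace Gyrogroup

theorem one_unique {G : Type*} [Gyrogroup G] (e : G) (he : ∀ g : G, e * g = g ∧ g * e = g) :
    e = 1 :=
  (op_one e).symm.trans (he 1).1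

theorem op_left_cancel {G : Type*} [Gyrogroup G] {a b c : G} (h : a * b = a * c) : b = c := by
  have h1 := gyr_assoc a⁻¹ a b
  rw [h, gyr_assoc a⁻¹ a c, inv_op, one_op, one_op] at h1
  exact ((gyr a⁻¹ a).injective h1).symm

theorem inv_unique {G : Type*} [Gyrogroup G] (g k : G) (h : g * k = 1) : k = g⁻¹ :=
  op_left_cancel (h.trans (op_inv g).symm)

theorem gyr_unique {G : Type*} [Gyrogroup G] (g h : G) (A : MulAut G)
    (hA : ∀ f : G, g * (h * f) = (g * h) * A f) : A = gyr g h :=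
  MulEquiv.ext fun f => op_left_cancel ((hA f).symm.trans (gyr_assoc g h f))

end Gyrogroup

/-- A subset is a subgyrogroup iff it is nonempty and closed under `⊖` and `⊕`. -/
structure IsSubgyrogroup {G : Type*} [Gyrogroup G] (H : Set G) : Prop where
  nonempty : H.Nonempty
  inv_mem : ∀ a ∈ H, a⁻¹ ∈ H
  op_mem : ∀ a ∈ H, ∀ b ∈ H, a * b ∈ H

/-- The subgyrogroup generated by `S`: the intersection of all subgyrogroups containing `S`. -/
def subgyrogroupClosure {G : Type*} [Gyrogroup G] (S : Set G) : Set G :=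
  ⋂₀ {H : Set G | IsSubgyrogroup H ∧ S ⊆ H}

/-- A gyrogroup with a topology is a topological gyrogroup if both operations are continuous. -/
class TopologicalGyrogroup (G : Type*) [TopologicalSpace G] [Gyrogroup G] : Prop
    extends ContinuousMul G, ContinuousInv G

/-- A topological gyrogroup is strongly topological if the identity has a neighborhood base
all of whose members are invariant under all gyroautomorphisms. -/
class StronglyTopologicalGyrogroup (G : Type*) [TopologicalSpace G] [Gyrogroup G] : Prop
    extends TopologicalGyrogroup G where
  exists_invariant_basis : ∃ 𝒰 : Set (Set G),
    (𝓝 (1 : G)).HasBasis (fun U => U ∈ 𝒰) id ∧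
      ∀ U ∈ 𝒰, ∀ x y : G, (Gyrogroup.gyr x y) '' U = U

/-- A strongly topologically orderable gyrogroup: a strongly topological gyrogroup whose topology
is the order topology of some total order. The order need not be related to the operation. -/
class StronglyTopologicallyOrderableGyrogroup (G : Type*) [TopologicalSpace G] [Gyrogroup G] :
    Prop extends StronglyTopologicalGyrogroup G where
  exists_linearOrder : ∃ _ : LinearOrder G, OrderTopology G

/-- A suitable set: `S` is discrete in its subspace topology, `S ∪ {1}` is closed, and the
subgyrogroup generated by `S` is dense. -/
structure IsSuitableSet {G : Type*} [TopologicalSpace G] [Gyrogroup G] (S : Set G) : Prop where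
  discrete : IsDiscrete S
  isClosed : IsClosed (S ∪ {1})
  dense : Dense (subgyrogroupClosure S)

open Filter Set Uniformity

namespace Gyrogroup

/-! ### Cancellation laws and the behaviour of `x⁻¹ * y` under gyrations. -/

section Algebra

variable {G : Type*} [Gyrogroup G]

/-! The order serves only to give Hausdorff separation and a countable base at `1`. If `𝓝[>] 1` were
not countably generated, every countable intersection of neighborhoods of `1` would contain some
`[1, z]`, so no sequence could tend to `1` strictly from above. Local compactness still puts
nontrivial convergent sequences in every `[1, z]`; left translation moves their limits to `1`, where
they must arrive from below. Two such sequences, at different scales, contradict each other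
(`isCountablyGenerated_nhdsGT_one`).

Gyration-invariant neighborhoods turn `x⁻¹ * y` into a uniformity, so a countable base at `1` gives
metrizability. The suitable set is a maximal separated set together with finite nets of smaller and
smaller neighborhoods of `1`; products of these approximate every point at every scale
(`exists_isSuitableSet`). -/

theorem gyr_one_left (x f : G) : gyr 1 x f = f := by
  have h := gyr_assoc 1 x f
  rw [one_op, one_op] at h
  exact (op_left_cancel h).symm

theorem inv_op_cancel_left (x z : G) : x⁻¹ * (x * z) = z := by
  rw [gyr_assoc, gyr_loop, inv_op, one_op, gyr_one_left]

theorem op_inv_cancel_left (x z : G) : x * (x⁻¹ * z) = z := by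
  rw [gyr_assoc, gyr_loop, op_inv, one_op, gyr_one_left]

/-- Left translation alters the difference `x⁻¹ * y` only by a gyration, which invariant
neighborhoods do not see. -/
theorem inv_op_op (a x y : G) : (a * x)⁻¹ * (a * y) = gyr a x (x⁻¹ * y) := by
  conv_lhs => rw [← op_inv_cancel_left x y, gyr_assoc a x, inv_op_cancel_left]

/-- This and `op_gyr_inv_op` provide the symmetry and the triangle law of the left uniformity. -/
theorem gyr_inv_op (x y : G) : gyr x⁻¹ y (y⁻¹ * x) = (x⁻¹ * y)⁻¹ := by
  apply inv_unique
  rw [← gyr_assoc, op_inv_cancel_left, inv_op]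

theorem op_gyr_inv_op (x y z : G) : (x⁻¹ * y) * gyr x⁻¹ y (y⁻¹ * z) = x⁻¹ * z := by
  rw [← gyr_assoc, op_inv_cancel_left]

theorem eq_of_inv_op_eq_one {x y : G} (h : x⁻¹ * y = 1) : y = x := by
  rw [← op_inv_cancel_left x y, h, op_one]

end Algebra

/-! ### First countability at the identity. -/

section Character

variable {G : Type*} [TopologicalSpace G]

/-- If the filter of right neighborhoods of a point is not countably generated, then it is closed
under countable intersections of neighborhoods. -/
theorem exists_Icc_subset_of_not_isCountablyGenerated [LinearOrder G] [OrderTopology G] {e : G}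
    (h : ¬ (𝓝[>] e).IsCountablyGenerated) (U : ℕ → Set G) (hU : ∀ n, U n ∈ 𝓝 e) :
    ∃ z, e < z ∧ ∀ n, Icc e z ⊆ U n := by
  have hne : ∃ z, e < z := by
    by_contra! hz
    refine h ?_
    have : Ioi e = ∅ := eq_empty_of_forall_notMem fun z hz' => (hz z).not_gt hz'
    rw [this, nhdsWithin_empty]
    infer_instance
  have hy : ∀ n, ∃ y, e < y ∧ Ico e y ⊆ U n := fun n => exists_Ico_subset_of_mem_nhds (hU n) hne
  choose y hey hyU using hy
  by_contra! hcon
  refine h ?_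
  -- If each `[e, z]` leaves some `U n`, then `y n ≤ z` for that `n`, so the countably many `Ioo e
  -- (y n)` form a basis.
  have hb : (𝓝[>] e).HasBasis (fun _ : ℕ => True) fun n => Ioo e (y n) := by
    refine ⟨fun t => ?_⟩
    rw [(nhdsGT_basis_of_exists_gt hne).mem_iff]
    constructor
    · rintro ⟨z, hz, hzt⟩
      obtain ⟨n, hn⟩ := hcon z hz
      refine ⟨n, trivial, fun x hx => hzt ⟨hx.1, ?_⟩⟩
      by_contra! hzx
      exact hn fun w hw => hyU n ⟨hw.1, hw.2.trans_lt (hzx.trans_lt hx.2)⟩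
    · rintro ⟨n, -, hn⟩
      exact ⟨y n, hey n, hn⟩
  exact hb.isCountablyGenerated

theorem eventually_lt_of_not_isCountablyGenerated [LinearOrder G] [OrderTopology G] {e : G}
    (h : ¬ (𝓝[>] e).IsCountablyGenerated) {b : ℕ → G} (hb : Tendsto b atTop (𝓝 e))
    (hne : ∀ n, b n ≠ e) : ∀ᶠ n in atTop, b n < e := by
  obtain ⟨z, hz, hzb⟩ := exists_Icc_subset_of_not_isCountablyGenerated h (fun n => {b n}ᶜ)
    fun n => isOpen_compl_singleton.mem_nhds (hne n).symm
  filter_upwards [hb (Iio_mem_nhds hz)] with n hn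
  by_contra! hlt
  exact hzb n ⟨hlt, le_of_lt hn⟩ rfl

/-- A strictly decreasing sequence in a compact set converges to its infimum, which exists as the
least point of the closure of its range. The limit `p` need not be `e`. -/
theorem exists_tendsto_ne_of_not_isCountablyGenerated [LinearOrder G] [OrderTopology G]
    [LocallyCompactSpace G] {e : G} (h : ¬ (𝓝[>] e).IsCountablyGenerated) {z : G} (hz : e < z) :
    ∃ p ∈ Icc e z, ∃ a : ℕ → G, (∀ n, a n ∈ Icc e z) ∧ (∀ n, a n ≠ p) ∧
      Tendsto a atTop (𝓝 p) := by
  obtain ⟨K, hK, hKe⟩ := exists_compact_mem_nhds e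
  obtain ⟨w, hw, hwK⟩ := exists_Icc_subset_of_not_isCountablyGenerated h (fun _ => K) fun _ => hKe
  have hbot : ∀ x, e < x → ∃ y, e < y ∧ y < x := by
    intro x hx
    by_contra! hcon
    refine h ?_
    have : 𝓝[>] e = ⊥ := by
      rw [← empty_mem_iff_bot]
      filter_upwards [Ioo_mem_nhdsGT hx] with y hy
      exact (hcon y hy.1).not_gt hy.2
    rw [this]
    infer_instance
  have hstep : ∀ x : Ioi e, ∃ y : Ioi e, y < x := fun x =>
    let ⟨y, h1, h2⟩ := hbot x x.2
    ⟨⟨y, h1⟩, h2⟩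
  choose s hs using hstep
  let c : ℕ → Ioi e := fun n => s^[n] ⟨min z w, lt_min hz hw⟩
  have hc : StrictAnti c := strictAnti_nat_of_succ_lt fun n => by
    simp only [c, Function.iterate_succ_apply']
    exact hs _
  let a : ℕ → G := fun n => c n
  have ha : StrictAnti a := fun m n hmn => hc hmn
  have hmem : ∀ n, a n ∈ Icc e (min z w) := fun n =>
    ⟨le_of_lt (c n).2, ha.antitone (Nat.zero_le n)⟩
  have hcl : closure (range a) ⊆ Icc e (min z w) :=
    closure_minimal (range_subset_iff.2 hmem) isClosed_Icc
  have hcomp : IsCompact (closure (range a)) :=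
    hK.of_isClosed_subset isClosed_closure
      ((hcl.trans (Icc_subset_Icc_right (min_le_right z w))).trans (hwK 0))
  obtain ⟨p, hp, hpl⟩ := hcomp.exists_isLeast (range_nonempty a).closure
  have hglb : IsGLB (range a) p := by
    refine ⟨fun x hx => hpl (subset_closure hx), fun x hx => ?_⟩
    rw [← lowerBounds_closure] at hx
    exact hx hp
  refine ⟨p, Icc_subset_Icc_right (min_le_left z w) (hcl hp), a,
    fun n => Icc_subset_Icc_right (min_le_left z w) (hmem n), fun n hn => ?_,
    tendsto_atTop_isGLB ha.antitone hglb⟩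
  exact (hglb.1 (mem_range_self (n + 1))).not_gt (hn ▸ ha (Nat.lt_succ_self n))

variable [Gyrogroup G] [TopologicalGyrogroup G]

theorem isCountablyGenerated_nhdsGT_one [LinearOrder G] [OrderTopology G]
    [LocallyCompactSpace G] : (𝓝[>] (1 : G)).IsCountablyGenerated := by
  by_contra h
  have key : ∀ z : G, 1 < z → ∃ p ∈ Icc 1 z, ∃ a : ℕ → G, (∀ n, a n ∈ Icc 1 z) ∧
      Tendsto (fun n => p⁻¹ * a n) atTop (𝓝 1) ∧ ∀ᶠ n in atTop, p⁻¹ * a n < 1 := by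
    intro z hz
    obtain ⟨p, hp, a, ha, hne, hlim⟩ := exists_tendsto_ne_of_not_isCountablyGenerated h hz
    have hb : Tendsto (fun n => p⁻¹ * a n) atTop (𝓝 1) := by
      rw [← inv_op p]
      exact hlim.const_mul _
    exact ⟨p, hp, a, ha, hb, eventually_lt_of_not_isCountablyGenerated h hb
      fun n hn => hne n (eq_of_inv_op_eq_one hn)⟩
  obtain ⟨z, hz, -⟩ := exists_Icc_subset_of_not_isCountablyGenerated h (fun _ => univ)
    fun _ => univ_mem
  obtain ⟨p, -, a, -, hb, hlt⟩ := key z hz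
  obtain ⟨N, hN⟩ := eventually_atTop.1 hlt
  -- The sequence below `1` serves as countably many lower bounds for differences of points near
  -- `1`.
  have hV : ∀ n, ∃ V ∈ 𝓝 (1 : G), ∀ x ∈ V, ∀ y ∈ V, p⁻¹ * a (n + N) < x⁻¹ * y := by
    intro n
    have hcont : Tendsto (fun q : G × G => q.1⁻¹ * q.2) (𝓝 1 ×ˢ 𝓝 1) (𝓝 1) := by
      have : Continuous fun q : G × G => q.1⁻¹ * q.2 := by fun_prop
      have := this.tendsto (1, 1)
      rwa [inv_op, nhds_prod_eq] at this
    obtain ⟨V, hV, hsub⟩ := mem_prod_same_iff.1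
      (hcont (Ioi_mem_nhds (hN (n + N) (Nat.le_add_left N n))))
    exact ⟨V, hV, fun x hx y hy => hsub (mk_mem_prod hx hy)⟩
  choose V hV hVlt using hV
  obtain ⟨w, hw, hwV⟩ := exists_Icc_subset_of_not_isCountablyGenerated h V hV
  obtain ⟨q, hq, c, hc, -, hclt⟩ := key w hw
  obtain ⟨m, hm⟩ := hclt.exists
  -- Both `q` and `c m` lie in every `V n`, so `q⁻¹ * c m` bounds a sequence tending to `1` from
  -- above, yet it is less than `1`.
  refine hm.not_ge (le_of_tendsto (hb.comp (tendsto_add_atTop_nat N)) (Eventually.of_forall ?_))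
  exact fun n => (hVlt n q (hwV n hq) (c m) (hwV n (hc m))).le

theorem isCountablyGenerated_nhds_one_of_orderTopology [o : LinearOrder G] [OrderTopology G]
    [LocallyCompactSpace G] : (𝓝 (1 : G)).IsCountablyGenerated := by
  have h1 : (𝓝[>] (1 : G)).IsCountablyGenerated := isCountablyGenerated_nhdsGT_one
  have h2 : (𝓝[<] (1 : G)).IsCountablyGenerated :=
    -- Reversing the order keeps the topology and swaps the two sides of `1`.
    @isCountablyGenerated_nhdsGT_one G _ _ _ (OrderDual.instLinearOrder G)
      (inferInstanceAs (OrderTopology Gᵒᵈ)) _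
  rw [← nhdsNE_sup_pure, ← nhdsLT_sup_nhdsGT]
  infer_instance

end Character

/-! ### The left uniformity and metrizability. -/

section Uniform

variable {G : Type*} [TopologicalSpace G] [Gyrogroup G]

theorem nhds_eq_comap_inv_op [TopologicalGyrogroup G] (x : G) :
    𝓝 x = comap (fun y => x⁻¹ * y) (𝓝 1) := by
  let e : G ≃ₜ G :=
    { toFun := fun y => x⁻¹ * y
      invFun := fun y => x * y
      left_inv := op_inv_cancel_left x
      right_inv := inv_op_cancel_left x
      continuous_toFun := continuous_const.mul continuous_id
      continuous_invFun := continuous_const.mul continuous_id }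
  have h := e.isInducing.nhds_eq_comap x
  rwa [show e x = 1 from inv_op x] at h

variable [StronglyTopologicalGyrogroup G]

theorem exists_gyr_invariant_subset {V : Set G} (hV : V ∈ 𝓝 (1 : G)) :
    ∃ U ∈ 𝓝 (1 : G), U ⊆ V ∧ ∀ x y z : G, gyr x y z ∈ U ↔ z ∈ U := by
  obtain ⟨𝒰, hb, hinv⟩ := StronglyTopologicalGyrogroup.exists_invariant_basis (G := G)
  obtain ⟨U, hU, hUV⟩ := hb.mem_iff.1 hV
  refine ⟨U, hb.mem_of_mem hU, hUV, fun x y z => ?_⟩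
  conv_lhs => rw [← hinv U hU x y]
  exact (gyr x y).injective.mem_set_image

variable (G) in
/-- The left uniformity of a strongly topological gyrogroup. -/
abbrev leftUniformSpace : UniformSpace G where
  toTopologicalSpace := inferInstance
  uniformity := comap (fun p : G × G => p.1⁻¹ * p.2) (𝓝 1)
  symm := by
    rw [tendsto_comap_iff]
    intro V hV
    obtain ⟨U, hU, hUV, hinv⟩ := exists_gyr_invariant_subset hV
    have hc : Tendsto (fun x : G => x⁻¹) (𝓝 1) (𝓝 1) := by
      have h := (continuous_inv (G := G)).tendsto 1
      rwa [← inv_unique (1 : G) 1 (one_op 1)] at h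
    refine ⟨_, hc hU, ?_⟩
    rintro ⟨x, y⟩ hxy
    refine hUV ?_
    change (x⁻¹ * y)⁻¹ ∈ U at hxy
    rwa [← gyr_inv_op, hinv] at hxy
  comp := by
    intro W hW
    obtain ⟨V, hV, hVW⟩ := hW
    have hcont : Tendsto (fun q : G × G => q.1 * q.2) (𝓝 1 ×ˢ 𝓝 1) (𝓝 1) := by
      have := (continuous_mul (M := G)).tendsto (1, 1)
      rwa [one_op, nhds_prod_eq] at this
    obtain ⟨O, hO, hOV⟩ := mem_prod_same_iff.1 (hcont hV)
    obtain ⟨U, hU, hUO, hinv⟩ := exists_gyr_invariant_subset hO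
    refine mem_of_superset (mem_lift' (preimage_mem_comap hU)) ?_
    rintro ⟨x, z⟩ ⟨y, hxy, hyz⟩
    refine hVW ?_
    change x⁻¹ * z ∈ V
    rw [← op_gyr_inv_op x y z]
    exact hOV (mk_mem_prod (hUO hxy) (hUO ((hinv _ _ _).2 hyz)))
  nhds_eq_comap_uniformity x := by
    rw [nhds_eq_comap_inv_op x, comap_comap]
    rfl

variable (G) in
theorem metrizableSpace_of_isCountablyGenerated_nhds_one [T0Space G]
    [(𝓝 (1 : G)).IsCountablyGenerated] : TopologicalSpace.MetrizableSpace G := by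
  let _ : UniformSpace G := leftUniformSpace G
  have : (𝓤 G).IsCountablyGenerated :=
    inferInstanceAs (comap (fun p : G × G => p.1⁻¹ * p.2) (𝓝 1)).IsCountablyGenerated
  exact UniformSpace.metrizableSpace

/-! ### Nets and the suitable set. -/

/-- A maximal `U`-separated set is closed and discrete, and its `U`-neighborhood is everything. -/
theorem exists_separated_net {U : Set G} (hU : U ∈ 𝓝 (1 : G)) :
    ∃ D : Set G, (∀ g, ∃ d ∈ D, d⁻¹ * g ∈ U) ∧ ∀ g, ∃ N ∈ 𝓝 g, (N ∩ D).Finite := by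
  let _ : UniformSpace G := leftUniformSpace G
  have hE : {p : G × G | p.1⁻¹ * p.2 ∈ U} ∈ 𝓤 G := preimage_mem_comap hU
  obtain ⟨E, hE, hsymm, hEU⟩ := symm_of_uniformity hE
  obtain ⟨D, hD⟩ := zorn_subset {D : Set G | D.Pairwise fun x y => (x, y) ∉ E} fun c hc hchain =>
    ⟨⋃₀ c, (pairwise_sUnion hchain.directedOn).2 fun s hs => hc hs,
      fun s hs => subset_sUnion_of_mem hs⟩
  have hsep : D.Pairwise fun x y => (x, y) ∉ E := hD.prop
  refine ⟨D, fun g => ?_, fun g => ?_⟩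
  · by_contra! hcon
    have hnot : ∀ d ∈ D, (d, g) ∉ E := fun d hd hdg => hcon d hd (hEU hdg)
    have hgD : g ∈ D := by
      refine hD.le_of_ge (y := insert g D) ?_ (subset_insert g D) (mem_insert g D)
      exact hsep.insert fun d hd _ => ⟨fun h => hnot d hd (hsymm.symm _ _ h), hnot d hd⟩
    exact hnot g hgD (refl_mem_uniformity hE)
  · obtain ⟨F, hF, hFsymm, hFE⟩ := comp_symm_mem_uniformity_sets hE
    refine ⟨_, mem_nhds_left g hF, Set.Subsingleton.finite ?_⟩
    rintro x ⟨hx, hxD⟩ y ⟨hy, hyD⟩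
    by_contra hne
    exact hsep hxD hyD hne (hFE ⟨g, hFsymm.symm _ _ hx, hy⟩)

theorem exists_finite_net {K A V : Set G} (hK : IsCompact K) (hA : A ⊆ K) (hV : V ∈ 𝓝 (1 : G)) :
    ∃ F ⊆ A, F.Finite ∧ ∀ x ∈ A, ∃ f ∈ F, f⁻¹ * x ∈ V := by
  let _ : UniformSpace G := leftUniformSpace G
  have hE : {p : G × G | p.1⁻¹ * p.2 ∈ V} ∈ 𝓤 G := preimage_mem_comap hV
  -- Total boundedness puts the net point in the second coordinate, hence the swapped entourage.
  obtain ⟨F, hFA, hF, hcov⟩ := totallyBounded_iff_subset.1 (hK.totallyBounded.subset hA) _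
    (symm_le_uniformity hE)
  refine ⟨F, hFA, hF, fun x hx => ?_⟩
  obtain ⟨f, hf, hfx⟩ := mem_iUnion₂.1 (hcov hx)
  exact ⟨f, hf, hfx⟩

theorem isSubgyrogroup_subgyrogroupClosure {G : Type*} [Gyrogroup G] (S : Set G) :
    IsSubgyrogroup (subgyrogroupClosure S) where
  nonempty := ⟨1, fun H hH => by
    obtain ⟨a, ha⟩ := hH.1.nonempty
    exact inv_op a ▸ hH.1.op_mem _ (hH.1.inv_mem a ha) _ ha⟩
  inv_mem a ha H hH := hH.1.inv_mem a (ha H hH)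
  op_mem a ha b hb H hH := hH.1.op_mem a (ha H hH) b (hb H hH)

theorem one_mem_subgyrogroupClosure {G : Type*} [Gyrogroup G] (S : Set G) :
    1 ∈ subgyrogroupClosure S := by
  have h := isSubgyrogroup_subgyrogroupClosure S
  obtain ⟨a, ha⟩ := h.nonempty
  exact inv_op a ▸ h.op_mem _ (h.inv_mem a ha) _ ha

/-- A set that is locally finite away from `1` and does not contain `1` is discrete, and becomes
closed when `1` is added. -/
theorem isDiscrete_and_isClosed_of_locallyFinite {X : Type*} [TopologicalSpace X] [T1Space X]
    {e : X} {T : Set X} (hT : ∀ g, g ≠ e → ∃ N ∈ 𝓝 g, (N ∩ T).Finite) :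
    IsDiscrete (T \ {e}) ∧ IsClosed (T \ {e} ∪ {e}) := by
  have hfin : ∀ g, g ≠ e → ∀ᶠ x in 𝓝 g, x ∈ T → x = g := by
    intro g hg
    obtain ⟨N, hN, hNT⟩ := hT g hg
    have hcl : IsClosed ((N ∩ T) \ {g}) := (hNT.subset sdiff_subset).isClosed
    filter_upwards [hN, hcl.isOpen_compl.mem_nhds fun h => h.2 rfl] with x hxN hx hxT
    by_contra hne
    exact hx ⟨⟨hxN, hxT⟩, hne⟩
  constructor
  · rw [isDiscrete_iff_forall_mem_exists_isOpen]
    rintro g ⟨hgT, hge⟩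
    obtain ⟨O, hO, hOo, hgO⟩ := eventually_nhds_iff.1 (hfin g hge)
    refine ⟨O, hOo, Subset.antisymm (fun x hx => hO x hx.1 hx.2.1) ?_⟩
    rintro _ rfl
    exact ⟨hgO, hgT, hge⟩
  · rw [← isOpen_compl_iff, isOpen_iff_mem_nhds]
    intro g hg
    have hge : g ≠ e := fun h => hg (Or.inr h)
    filter_upwards [hfin g hge, isOpen_compl_singleton.mem_nhds hge] with x hx hxe hxT
    rcases hxT with hxT | hxe'
    · exact hg (Or.inl (hx hxT.1 ▸ hxT))
    · exact hxe hxe'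

variable (G) in
/-- A locally compact, first countable, strongly topological gyrogroup has a suitable set. -/
theorem exists_isSuitableSet [T2Space G] [LocallyCompactSpace G]
    [(𝓝 (1 : G)).IsCountablyGenerated] : ∃ S : Set G, IsSuitableSet S := by
  obtain ⟨K, hK, hK1⟩ := exists_compact_mem_nhds (1 : G)
  obtain ⟨B, hB⟩ := (𝓝 (1 : G)).exists_antitone_basis
  have hU : ∀ n, ∃ U ∈ 𝓝 (1 : G), U ⊆ B n ∩ K ∧ ∀ x y z : G, gyr x y z ∈ U ↔ z ∈ U :=
    fun n => exists_gyr_invariant_subset (inter_mem (hB.mem n) hK1)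
  choose U hU1 hUBK hinv using hU
  have hF : ∀ n, ∃ F ⊆ U n, F.Finite ∧ ∀ x ∈ U n, ∃ f ∈ F, f⁻¹ * x ∈ U (n + 1) := fun n =>
    exists_finite_net hK (fun x hx => (hUBK n hx).2) (hU1 (n + 1))
  choose F hFU hFfin hFcov using hF
  obtain ⟨D, hDcov, hDfin⟩ := exists_separated_net (hU1 0)
  -- The sets `F n ⊆ U n ⊆ B n` shrink to `1`, so only finitely many of them come near any other
  -- point.
  let T : Set G := D ∪ ⋃ n, F n
  have hT : ∀ g, g ≠ 1 → ∃ N ∈ 𝓝 g, (N ∩ T).Finite := by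
    intro g hg
    obtain ⟨N, hN, hND⟩ := hDfin g
    obtain ⟨O, hO, W, hW, hdisj⟩ := Filter.disjoint_iff.1 (disjoint_nhds_nhds.2 hg)
    obtain ⟨m, -, hm⟩ := hB.1.mem_iff.1 hW
    refine ⟨N ∩ O, inter_mem hN hO, (hND.union
      ((Set.finite_Iio m).biUnion fun n _ => hFfin n)).subset ?_⟩
    rintro x ⟨⟨hxN, hxO⟩, hxD | hxF⟩
    · exact Or.inl ⟨hxN, hxD⟩
    · obtain ⟨n, hn⟩ := mem_iUnion.1 hxF
      refine Or.inr (mem_iUnion₂.2 ⟨n, ?_, hn⟩)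
      by_contra! hmn
      exact disjoint_left.1 hdisj hxO (hm (hB.antitone (not_lt.1 hmn) (hUBK n (hFU n hn)).1))
  obtain ⟨hdisc, hclosed⟩ := isDiscrete_and_isClosed_of_locallyFinite hT
  refine ⟨T \ {1}, hdisc, hclosed, ?_⟩
  set H := subgyrogroupClosure (T \ {1})
  have hsub : IsSubgyrogroup H := isSubgyrogroup_subgyrogroupClosure _
  have hTH : T ⊆ H := by
    intro t ht
    by_cases h1 : t = 1
    · exact h1 ▸ one_mem_subgyrogroupClosure _
    · exact fun L hL => hL.2 ⟨ht, h1⟩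
  have happrox : ∀ (g : G) (n : ℕ), ∃ h ∈ H, h⁻¹ * g ∈ U n := by
    intro g n
    induction n with
    | zero =>
      obtain ⟨d, hd, hdg⟩ := hDcov g
      exact ⟨d, hTH (Or.inl hd), hdg⟩
    | succ n ih =>
      obtain ⟨h, hh, hhg⟩ := ih
      obtain ⟨f, hf, hfg⟩ := hFcov n _ hhg
      -- By `inv_op_op`, `(h * f)⁻¹ * g` is a gyration of `f⁻¹ * (h⁻¹ * g)`, which lies in the
      -- invariant set `U (n + 1)`.
      refine ⟨h * f, hsub.op_mem h hh f (hTH (Or.inr (mem_iUnion.2 ⟨n, hf⟩))), ?_⟩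
      have := (hinv (n + 1) h f _).2 hfg
      rwa [← inv_op_op, op_inv_cancel_left] at this
  intro g
  rw [mem_closure_iff_nhds]
  intro O hO
  let _ : UniformSpace G := leftUniformSpace G
  -- The approximation controls `h⁻¹ * g`, not `g⁻¹ * h`, so the symmetric description of `𝓝 g` is
  -- needed.
  obtain ⟨V, hV, hVO⟩ := mem_nhds_uniformity_iff_left.1 hO
  obtain ⟨n, -, hn⟩ := hB.1.mem_iff.1 hV
  obtain ⟨h, hh, hhg⟩ := happrox g n
  exact ⟨h, @hVO (h, g) (hn (hUBK n hhg).1) rfl, hh⟩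

end Uniform

end Gyrogroup

theorem theorem4p10 {G : Type*} [TopologicalSpace G] [Gyrogroup G]
    [StronglyTopologicallyOrderableGyrogroup G] [LocallyCompactSpace G] :
    TopologicalSpace.MetrizableSpace G ∧ ∃ S : Set G, IsSuitableSet S := by
  obtain ⟨_, _⟩ := StronglyTopologicallyOrderableGyrogroup.exists_linearOrder (G := G)
  have : (𝓝 (1 : G)).IsCountablyGenerated :=
    Gyrogroup.isCountablyGenerated_nhds_one_of_orderTopology
  exact ⟨Gyrogroup.metrizableSpace_of_isCountablyGenerated_nhds_one G,
    Gyrogroup.exists_isSuitableSet G⟩
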